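/- Let $T_0\subset\mathbb{R}^2$ be the T-shaped polygon $[0,1]\times[0,1]\,\cup\,[-\tfrac12,\tfrac32]\times[1,\tfrac32]$. For every finite binary string $s$ let $T^s$ be the copy of $T_0$ scaled by $2^{-|s|}$ defined as follows: $T^{\epsilon}=T_0$ for the empty string $\epsilon$, and $T^{s0}$ (resp. $T^{s1}$) stands, with the bottom side of its square, on the left-most (resp. right-most) quarter of the top side of $T^s$. The $T$-fractal billiard table is $T_\infty=\bigcup_s T^s$. The $T$-fractal surface $\mathring{\mathcal T}$ is the translation surface obtained by unfolding $T_\infty$: take the four images of $T_\infty$ with its corners removed under the group generated by the reflections in the horizontal and the vertical axis, and glue, for each side of $T_\infty$, its images in the copies indexed by $g$ and $rg$ by a translation, where $r$ is the reflection in the axis parallel to that side. Give $\mathring{\mathcal T}$ its flat path metric (the infimum of the Euclidean lengths of curves), and let $\mathcal T$ be its metric completion. For a finite binary string $s$, the quad-T subsurface $\mathcal Q^s\subset\mathcal T$ is the closure of the part of $\mathring{\mathcal T}$ lying over $T^s$. The set of elusive singularities is $$\mathcal E=\mathcal T\setminus\bigcup_{s}\mathcal Q^s .$$ For $x\in\mathring{\mathcal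 T}$ let $\sigma(x)$ be the string $s$ with $x\in\mathcal Q^s$, the shorter one if $x$ lies in two quad-T subsurfaces. Say that a sequence $(y_n)_{n\ge 0}$ in $\mathring{\mathcal T}$ climbs if, for every $n$, $|\sigma(y_n)|=n$ and $\sigma(y_n)$ is an initial segment of $\sigma(y_{n+1})$. Proposition. The points of $\mathcal E$ are in one-to-one correspondence with the infinite binary strings, by recording the branches that Cauchy sequences climb. Precisely, there is a bijection $\alpha:\mathcal E\to\{0,1\}^{\mathbb N}$ such that (1) every $x\in\mathcal E$ is the limit in $\mathcal T$ of a climbing Cauchy sequence of points of $\mathring{\mathcal T}$; (2) for every $x\in\mathcal E$ and every climbing sequence $(y_n)$ in $\mathring{\mathcal T}$, $y_n\to x$ in $\mathcal T$ if and only if, for every $n$, $\sigma(y_n)$ is the string of the first $n$ bits of $\alpha(x)$. -/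

import Mathlib

open Set Filter Topology

noncomputable section

namespace TFractal

/-! ## The billiard table, as a subset of the Euclidean plane `ℂ` -/

/-- The T-shaped polygon: the unit square with a `2 × 1/2` rectangle centred on top of it. -/
def tPolygon : Set ℂ :=
  {z | 0 ≤ z.re ∧ z.re ≤ 1 ∧ 0 ≤ z.im ∧ z.im ≤ 1} ∪
  {z | -1 / 2 ≤ z.re ∧ z.re ≤ 3 / 2 ∧ 1 ≤ z.im ∧ z.im ≤ 3 / 2}

/-- The similarity of ratio `1/2` that puts a half-size copy of the T-shaped polygon on the top
left portion (bit `0 = false`) or the top right portion (bit `1 = true`) of the polygon. -/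
def attach (b : Bool) (z : ℂ) : ℂ :=
  z / 2 + (if b then 1 else -1 / 2) + (3 / 2) * Complex.I

/-- The similarity of ratio `2 ^ (-|s|)` that carries the T-shaped polygon to its copy with
index `s`; the copies `s0` and `s1` sit on the top left and top right of the copy `s`. -/
def place : List Bool → ℂ → ℂ
  | [], z => z
  | b :: s, z => attach b (place s z)

/-- The scaled copy of the T-shaped polygon indexed by the finite binary string `s`. -/
def cell (s : List Bool) : Set ℂ := place s '' tPolygon

/-- The `n`-th level approximation `T_n` of the T-fractal. -/
def level : ℕ → Set ℂ
  | 0 => tPolygon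
  | n + 1 => level n ∪ ⋃ (s : List Bool) (_ : s.length = n + 1), cell s

/-- The T-fractal billiard table `T_∞`. -/
def table : Set ℂ := ⋃ n, level n

/-- `p` is an interior point of a vertical side of the table. -/
def OnVerticalSide (p : ℂ) : Prop :=
  ∃ ε > (0 : ℝ), ∀ t : ℝ, |t| < ε → p + t * Complex.I ∈ table ∩ frontier table

/-- `p` is an interior point of a horizontal side of the table. -/
def OnHorizontalSide (p : ℂ) : Prop :=
  ∃ ε > (0 : ℝ), ∀ t : ℝ, |t| < ε → p + t ∈ table ∩ frontier table

/-- The corners of the table: the boundary points that are not interior to a side. -/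
def corners : Set ℂ :=
  {p | p ∈ table ∩ frontier table ∧ ¬ OnVerticalSide p ∧ ¬ OnHorizontalSide p}

/-- The billiard table with its corners removed. -/
abbrev OpenTable : Type := {p : ℂ // p ∈ table \ corners}

/-! ## The unfolding -/

/-- The four elements of the Klein four-group generated by the reflections in the sides, which
label the reflected copies of the table: `(a, b)` is the map `x + i y ↦ ± x ± i y` with a minus
sign in front of `x` iff `a`, and in front of `y` iff `b`. -/
abbrev Sheet : Type := Bool × Bool

/-- The side identifications of the unfolding: a point `p` of a side is the same point in the
sheet `g` and in the sheet `r g`, where `r` is the reflection in a line parallel to that side. -/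
inductive Glue : Sheet × OpenTable → Sheet × OpenTable → Prop
  | vertical (a b : Bool) (p : OpenTable) (h : OnVerticalSide p) : Glue ((a, b), p) ((!a, b), p)
  | horizontal (a b : Bool) (p : OpenTable) (h : OnHorizontalSide p) :
      Glue ((a, b), p) ((a, !b), p)

/-- The T-fractal surface as a topological space: four copies of the table, without its corners,
glued along their sides (quotient topology). -/
abbrev Unfolding : Type := Quot Glue

/-- The projection of the surface to the table. -/
def fold : Unfolding → ℂ :=
  Quot.lift (fun x => (x.2 : ℂ)) (by rintro _ _ (_ | _) <;> rfl)

/-- The Euclidean length of a curve in the surface. In a translation chart the surface is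
developed isometrically, sheet by sheet, and `fold` differs from the chart on each sheet by a
Euclidean isometry, so that `fold` preserves the length of curves. -/
def length {x y : Unfolding} (γ : Path x y) : ENNReal :=
  eVariationOn (fun t => fold (γ t)) univ

/-- The distance of the flat metric: the infimum of the lengths of the curves from `x` to `y`. -/
def flatDist (x y : Unfolding) : ENNReal := ⨅ γ : Path x y, length γ

theorem flatDist_self (x : Unfolding) : flatDist x x = 0 := by
  refine le_antisymm ((iInf_le _ (Path.refl x)).trans (le_of_eq ?_)) bot_le
  exact eVariationOn.constant_on (by rintro _ ⟨_, _, rfl⟩ _ ⟨_, _, rfl⟩; rfl)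

theorem length_symm {x y : Unfolding} (γ : Path x y) : length γ.symm ≤ length γ := by
  unfold length
  exact eVariationOn.comp_le_of_antitoneOn (fun t => fold (γ t)) unitInterval.symm
    (fun a _ b _ h => unitInterval.symm_le_symm.2 h) (fun _ _ => mem_univ _)

theorem flatDist_comm (x y : Unfolding) : flatDist x y = flatDist y x :=
  le_antisymm (le_iInf fun γ => (iInf_le _ γ.symm).trans (length_symm γ))
    (le_iInf fun γ => (iInf_le _ γ.symm).trans (length_symm γ))

theorem length_trans {x y z : Unfolding} (γ : Path x y) (δ : Path y z) :
    length (γ.trans δ) ≤ length γ + length δ := by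
  have hmid : (0 : ℝ) ≤ 1 / 2 ∧ (1 / 2 : ℝ) ≤ 1 := by norm_num
  let c : unitInterval := ⟨1 / 2, hmid⟩
  have hu : (univ : Set unitInterval) = Iic c ∪ Ici c := Iic_union_Ici.symm
  unfold length
  rw [hu, eVariationOn.union _ isGreatest_Iic isLeast_Ici]
  refine add_le_add ?_ ?_
  · let φ : unitInterval → unitInterval := fun t => projIcc 0 1 zero_le_one (2 * (t : ℝ))
    have hφ : MonotoneOn φ (Iic c) := fun a _ b _ h =>
      monotone_projIcc _ (mul_le_mul_of_nonneg_left (show (a : ℝ) ≤ b from h) zero_le_two)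
    have he : EqOn (fun t => fold ((γ.trans δ) t)) ((fun t => fold (γ t)) ∘ φ) (Iic c) := by
      intro t ht
      have ht' : (t : ℝ) ≤ 1 / 2 := ht
      have hm : 2 * (t : ℝ) ∈ unitInterval := ⟨by linarith [t.2.1], by linarith⟩
      simp only [Path.trans_apply, ht', dite_true, Function.comp, φ, projIcc_of_mem _ hm]
    rw [eVariationOn.congr he]
    exact eVariationOn.comp_le_of_monotoneOn _ φ hφ fun t _ => le_total (φ t) c
  · let φ : unitInterval → unitInterval := fun t => projIcc 0 1 zero_le_one (2 * (t : ℝ) - 1)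
    have hφ : MonotoneOn φ (Ici c) := fun a _ b _ h =>
      monotone_projIcc _ (by have : (a : ℝ) ≤ b := h; linarith)
    have he : EqOn (fun t => fold ((γ.trans δ) t)) ((fun t => fold (δ t)) ∘ φ) (Ici c) := by
      intro t ht
      have ht' : 1 / 2 ≤ (t : ℝ) := ht
      have hm : 2 * (t : ℝ) - 1 ∈ unitInterval := ⟨by linarith, by linarith [t.2.2]⟩
      simp only [Path.trans_apply, Function.comp, φ, projIcc_of_mem _ hm]
      split_ifs with h
      · have h2 : (t : ℝ) = 1 / 2 := le_antisymm h ht'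
        have e1 : (⟨2 * (t : ℝ), (unitInterval.mul_pos_mem_iff zero_lt_two).2 ⟨t.2.1, h⟩⟩ :
            unitInterval) = 1 := Subtype.ext (by simp [h2])
        have e2 : (⟨2 * (t : ℝ) - 1, hm⟩ : unitInterval) = 0 := Subtype.ext (by simp [h2])
        rw [e1, e2, γ.target, δ.source]
      · rfl
    rw [eVariationOn.congr he]
    exact eVariationOn.comp_le_of_monotoneOn _ φ hφ fun t _ => le_total (φ t) c

theorem flatDist_triangle (x y z : Unfolding) :
    flatDist x z ≤ flatDist x y + flatDist y z := by
  exact ENNReal.le_iInf_add_iInf fun γ δ => (iInf_le _ (γ.trans δ)).trans (length_trans γ δ)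

/-- The T-fractal surface, as a metric space. -/
def Surface : Type := Unfolding

instance : PseudoEMetricSpace Surface where
  edist := flatDist
  edist_self := flatDist_self
  edist_comm := flatDist_comm
  edist_triangle := flatDist_triangle

/-- The metric completion of the T-fractal surface. -/
abbrev SurfaceCompletion : Type := UniformSpace.Completion Surface

/-! ## Quad-T subsurfaces and elusive singularities -/

/-- The part of the surface lying over the copy `s` of the T-shaped polygon (the quad-T
surface with index `s`, without the removed corners): four scaled copies of the polygon. -/
def puncturedQuadT (s : List Bool) : Set Surface := {x | fold x ∈ cell s}

/-- The quad-T subsurface with index `s`, completed, inside the completion of the surface: the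
closure of the part over the copy `s`, so that it contains the corners of that part. -/
def quadT (s : List Bool) : Set SurfaceCompletion :=
  closure ((fun x : Surface => (x : SurfaceCompletion)) '' puncturedQuadT s)

/-- The elusive singularities: the points of the completion that lie in no quad-T subsurface. -/
def elusive : Set SurfaceCompletion := (⋃ s : List Bool, quadT s)ᶜ

theorem exists_mem_puncturedQuadT (x : Surface) : {s : List Bool | x ∈ puncturedQuadT s}.Nonempty := by
  have key : ∀ n, ∀ p ∈ level n, ∃ s, p ∈ cell s := by
    intro n
    induction n with
    | zero => exact fun p hp => ⟨[], p, hp, rfl⟩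
    | succ n ih =>
      rintro p (hp | hp)
      · exact ih p hp
      · obtain ⟨s, _, hs⟩ := mem_iUnion₂.1 hp
        exact ⟨s, hs⟩
  have htable : fold x ∈ table := by
    induction x using Quot.ind with
    | mk a => exact a.2.2.1
  obtain ⟨n, hn⟩ := mem_iUnion.1 htable
  exact key n _ hn

/-- The index of the quad-T subsurface that contains `x`, the shorter one if `x` lies on a common
boundary component of two of them. -/
def label (x : Surface) : List Bool :=
  Function.argminOn List.length {s | x ∈ puncturedQuadT s} (exists_mem_puncturedQuadT x)

/-- A sequence in the surface that climbs through nested quad-T subsurfaces, one level at each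
step. -/
def Climbs (y : ℕ → Surface) : Prop :=
  ∀ n, (label (y n)).length = n ∧ label (y n) <+: label (y (n + 1))

/-- The string of the first `n` bits of an infinite binary string. -/
def prefixOf (w : ℕ → Bool) (n : ℕ) : List Bool := List.ofFn fun i : Fin n => w i

end TFractal

end

open Set Filter Topology

noncomputable section

namespace TFractal

/-! ## The similarities `place s` -/

/-! The surface over the copies whose index extends `s` is a subtree, and two estimates control
these subtrees. Upper bound: the subtree at `s` has diameter at most `96 / 2 ^ |s|`, all four sheets
included, because each copy has a vertical and a horizontal side through which a short curve changes
sheet (`flatDist_le_of_mem_subtree`). Lower bound: a curve between two distinct subtrees of level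
`n` must come down to height `3 - 3 / 2 ^ n`, and `fold` does not increase distances
(`le_flatDist_of_ne`).

By the upper bound, the subtrees along an infinite string `w` generate a Cauchy filter; its limit
`branchEnd w` is elusive because heights over a fixed copy stay below those far along the branch.
Conversely, near an elusive point the finitely many copies of length at most `n` are absent, so all
nearby points are high. The lower bound then puts them in a single subtree of level `n`
(`exists_subtree_mem_trace`). These subtrees are nested and spell out the string of the point. Since
subtrees of one level are disjoint, they also determine the labels of any climbing sequence that
converges to the point. -/

/-- The height of the bottom side of the copies of generation `n`. -/
def height (n : ℕ) : ℝ := 3 - 3 / 2 ^ n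

theorem height_succ (n : ℕ) : height (n + 1) = height n + (3 / 2) / 2 ^ n := by
  simp only [height, pow_succ]; field_simp; ring

theorem height_strictMono : StrictMono height :=
  strictMono_nat_of_lt_succ fun n => by
    rw [height_succ]; have : (0 : ℝ) < (3 / 2) / 2 ^ n := by positivity
    linarith

theorem dist_le_abs_add_abs (z w : ℂ) : dist z w ≤ |z.re - w.re| + |z.im - w.im| := by
  rw [Complex.dist_eq]
  exact Complex.norm_le_abs_re_add_abs_im (z - w)

theorem attach_re (b : Bool) (z : ℂ) :
    (attach b z).re = z.re / 2 + if b then 1 else -1 / 2 := by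
  cases b <;> simp [attach]

theorem attach_im (b : Bool) (z : ℂ) : (attach b z).im = z.im / 2 + 3 / 2 := by
  cases b <;> simp [attach]

theorem attach_injective (b : Bool) : Function.Injective (attach b) := by
  intro z z' h
  simp only [attach, add_left_inj] at h
  exact (div_left_inj' two_ne_zero).1 h

theorem place_eq (s : List Bool) (z : ℂ) :
    place s z = place s 0 + ((1 / 2 ^ s.length : ℝ) : ℂ) * z := by
  induction s with
  | nil => simp [place]
  | cons b s ih =>
    simp only [place, attach]
    rw [ih]
    push_cast [List.length_cons, pow_succ]
    field_simp
    ring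

theorem place_im (s : List Bool) (z : ℂ) :
    (place s z).im = height s.length + z.im / 2 ^ s.length := by
  induction s with
  | nil => simp [place, height]
  | cons b s ih =>
    simp only [place, attach_im, ih, List.length_cons, height, pow_succ]
    field_simp
    ring

theorem place_append (s t : List Bool) (z : ℂ) : place (s ++ t) z = place s (place t z) := by
  induction s with
  | nil => rfl
  | cons b s ih => simp [place, ih]

theorem place_add_smul (s : List Bool) (z u : ℂ) (t : ℝ) :
    place s z + t * u = place s (z + (t * 2 ^ s.length : ℝ) * u) := by
  rw [place_eq s z, place_eq s (z + _)]
  push_cast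
  field_simp
  ring

theorem continuous_place (s : List Bool) : Continuous (place s) := by
  rw [show place s = _ from funext (place_eq s)]; fun_prop

theorem isOpenMap_place (s : List Bool) : IsOpenMap (place s) := by
  have h : ((1 / 2 ^ s.length : ℝ) : ℂ) ≠ 0 := by
    simp
  have := (isOpenMap_add_left (place s 0)).comp (Homeomorph.mulLeft₀ _ h).isOpenMap
  rwa [show place s = _ from funext (place_eq s)]

theorem dist_place (s : List Bool) (z w : ℂ) :
    dist (place s z) (place s w) = dist z w / 2 ^ s.length := by
  rw [place_eq s z, place_eq s w, dist_add_left, dist_eq_norm, ← mul_sub, norm_mul, dist_eq_norm,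
    Complex.norm_real]
  rw [Real.norm_of_nonneg (by positivity)]
  ring

theorem place_re_mem (s : List Bool) {z : ℂ} (hz : z.re ∈ Ioo (-1 : ℝ) 2) :
    (place s z).re ∈ Ioo (-1 : ℝ) 2 := by
  induction s with
  | nil => exact hz
  | cons b s ih =>
    obtain ⟨h1, h2⟩ := ih
    simp only [place, attach_re, mem_Ioo]
    cases b <;> simp <;> constructor <;> linarith

/-- `attach false` and `attach true` send the strip `-1 < re < 2` into its disjoint halves, to the
left and right of `re = 1/2`, so the real part of the image determines each bit in turn. -/
theorem place_inj {s r : List Bool} (h : s.length = r.length) {z w : ℂ}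
    (hz : z.re ∈ Ioo (-1 : ℝ) 2) (hw : w.re ∈ Ioo (-1 : ℝ) 2) (e : place s z = place r w) :
    s = r ∧ z = w := by
  induction s generalizing r with
  | nil =>
    obtain rfl : r = [] := List.length_eq_zero_iff.1 h.symm
    exact ⟨rfl, e⟩
  | cons b s ih =>
    cases r with
    | nil => simp at h
    | cons c r =>
      have hb : b = c := by
        have h1 := place_re_mem s hz
        have h2 := place_re_mem r hw
        have h3 := congrArg Complex.re e
        simp only [place, attach_re] at h3
        rw [mem_Ioo] at h1 h2
        cases b <;> cases c <;> simp at h3 ⊢ <;> linarith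
      subst hb
      obtain ⟨h1, h2⟩ := ih (by simpa using h) (attach_injective b e)
      exact ⟨by rw [h1], h2⟩

/-! ## Cells -/

theorem tPolygon_re {z : ℂ} (hz : z ∈ tPolygon) : z.re ∈ Ioo (-1 : ℝ) 2 := by
  rcases hz with ⟨h1, h2, -, -⟩ | ⟨h1, h2, -, -⟩ <;> constructor <;> linarith

theorem tPolygon_im {z : ℂ} (hz : z ∈ tPolygon) : 0 ≤ z.im ∧ z.im ≤ 3 / 2 := by
  rcases hz with ⟨-, -, h1, h2⟩ | ⟨-, -, h1, h2⟩ <;> constructor <;> linarith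

theorem mem_table {p : ℂ} : p ∈ table ↔ ∃ s, p ∈ cell s := by
  constructor
  · intro h
    obtain ⟨n, hn⟩ := mem_iUnion.1 h
    induction n with
    | zero => exact ⟨[], p, hn, rfl⟩
    | succ n ih =>
      rcases hn with hn | hn
      · exact ih hn
      · obtain ⟨s, _, hs⟩ := mem_iUnion₂.1 hn
        exact ⟨s, hs⟩
  · rintro ⟨s, hs⟩
    refine mem_iUnion.2 ⟨s.length, ?_⟩
    cases s with
    | nil => obtain ⟨z, hz, rfl⟩ := hs; exact hz
    | cons b s => exact Or.inr (mem_iUnion₂.2 ⟨b :: s, rfl, hs⟩)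

theorem cell_im {s : List Bool} {p : ℂ} (hp : p ∈ cell s) :
    height s.length ≤ p.im ∧ p.im ≤ height (s.length + 1) := by
  obtain ⟨z, hz, rfl⟩ := hp
  obtain ⟨h1, h2⟩ := tPolygon_im hz
  rw [place_im, height_succ]
  exact ⟨le_add_of_nonneg_right (by positivity), by gcongr⟩

/-- The height leaves only the length of `s` for `r`, and disjointness of strips then leaves only
`s`. Heights `0` and `3/2` are excluded because neighbouring copies meet there. -/
theorem eq_of_place_mem_cell {s r : List Bool} {z : ℂ} (hre : z.re ∈ Ioo (-1 : ℝ) 2)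
    (him : z.im ∈ Ioo (0 : ℝ) (3 / 2)) (h : place s z ∈ cell r) : r = s ∧ z ∈ tPolygon := by
  obtain ⟨h1, h2⟩ := cell_im h
  rw [place_im] at h1 h2
  have h3 : 0 < z.im / 2 ^ s.length := div_pos him.1 (by positivity)
  have h4 : z.im / 2 ^ s.length < (3 / 2) / 2 ^ s.length := by have := him.2; gcongr
  have h5 : r.length < s.length + 1 :=
    height_strictMono.lt_iff_lt.1 (by rw [height_succ]; linarith)
  have h6 : s.length < r.length + 1 := height_strictMono.lt_iff_lt.1 (by linarith)
  obtain ⟨w, hw, e⟩ := h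
  obtain ⟨rfl, rfl⟩ := place_inj (by omega) (tPolygon_re hw) hre e
  exact ⟨rfl, hw⟩

theorem eq_of_mem_cell_append {s s' t t' : List Bool} (h : s.length = s'.length) {p : ℂ}
    (hp : p ∈ cell (s ++ t)) (hp' : p ∈ cell (s' ++ t')) : s = s' := by
  obtain ⟨z, hz, rfl⟩ := hp
  obtain ⟨w, hw, e⟩ := hp'
  rw [place_append, place_append] at e
  exact (place_inj h.symm (place_re_mem _ (tPolygon_re hw)) (place_re_mem _ (tPolygon_re hz))
    e).1.symm

/-! ### Interior points and sides of the table -/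

theorem notMem_corners_of_mem_nhds {p : ℂ} (h : table ∈ 𝓝 p) : p ∉ corners :=
  fun hc => hc.1.2.2 (mem_interior_iff_mem_nhds.2 h)

theorem place_mem_interior {s : List Bool} {O : Set ℂ} (hO : IsOpen O)
    (h : ∀ z ∈ O, place s z ∈ table) {z : ℂ} (hz : z ∈ O) : table ∈ 𝓝 (place s z) :=
  mem_of_superset ((isOpenMap_place s _ hO).mem_nhds (mem_image_of_mem _ hz))
    (image_subset_iff.2 h)

theorem place_mem_frontier {s : List Bool} {z : ℂ} (hz : z ∈ tPolygon)
    (h : z ∈ closure {w : ℂ | w.re ∈ Ioo (-1 : ℝ) 2 ∧ w.im ∈ Ioo (0 : ℝ) (3 / 2) ∧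
      w ∉ tPolygon}) : place s z ∈ table ∩ frontier table := by
  have ht : place s z ∈ table := mem_table.2 ⟨s, z, hz, rfl⟩
  refine ⟨ht, ?_⟩
  rw [frontier_eq_closure_inter_closure]
  refine ⟨subset_closure ht, map_mem_closure (continuous_place s) h ?_⟩
  rintro w ⟨h1, h2, h3⟩ hw
  obtain ⟨r, hr⟩ := mem_table.1 hw
  exact h3 (eq_of_place_mem_cell h1 h2 hr).2

/-- The middle of the left side of the square: just to its left lies a gap that no other copy can
fill. -/
theorem onVerticalSide_place (s : List Bool) : OnVerticalSide (place s ⟨0, 1 / 2⟩) := by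
  refine ⟨1 / 4 / 2 ^ s.length, by positivity, fun t ht => ?_⟩
  have e : place s ⟨0, 1 / 2⟩ + t * Complex.I = place s ⟨0, 1 / 2 + t * 2 ^ s.length⟩ := by
    rw [place_add_smul]
    congr 1
    apply Complex.ext <;> simp only [Complex.add_re, Complex.add_im, Complex.re_ofReal_mul,
      Complex.im_ofReal_mul, Complex.I_re, Complex.I_im] <;> ring
  have h2 : (0 : ℝ) < 2 ^ s.length := by positivity
  rw [lt_div_iff₀ h2, ← abs_of_pos h2, ← abs_mul, abs_lt] at ht
  clear h2
  generalize t * 2 ^ s.length = u at *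
  rw [e]
  refine place_mem_frontier (Or.inl ⟨le_rfl, zero_le_one, ?_, ?_⟩) ?_
  · show 0 ≤ 1 / 2 + u
    linarith
  · show 1 / 2 + u ≤ 1
    linarith
  · rw [Metric.mem_closure_iff]
    intro ε hε
    -- The bound `1 / 2` keeps the test point in the box reserved for the copy `s`; `ε / 2` makes it
    -- close.
    have h0 : 0 < min (ε / 2) (1 / 2) := lt_min (by linarith) (by norm_num)
    have h1 := min_le_left (ε / 2) (1 / 2)
    have h2 := min_le_right (ε / 2) (1 / 2)
    generalize min (ε / 2) (1 / 2) = δ at *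
    refine ⟨⟨-δ, 1 / 2 + u⟩, ⟨⟨?_, ?_⟩, ⟨?_, ?_⟩, ?_⟩, ?_⟩
    · show -1 < -δ
      linarith
    · show -δ < 2
      linarith
    · show 0 < 1 / 2 + u
      linarith
    · show 1 / 2 + u < 3 / 2
      linarith
    · rintro (⟨h, -⟩ | ⟨-, -, h, -⟩)
      · change 0 ≤ -δ at h
        linarith
      · change 1 ≤ 1 / 2 + u at h
        linarith
    · refine (dist_le_abs_add_abs _ _).trans_lt ?_
      simp only [sub_self, sub_neg_eq_add, zero_add, abs_zero, add_zero, abs_of_pos h0]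
      linarith

/-- The point is on the underside of the left overhang of the bar, where the gap below is again
inside the box reserved for `s`. -/
theorem onHorizontalSide_place (s : List Bool) : OnHorizontalSide (place s ⟨-1 / 4, 1⟩) := by
  refine ⟨1 / 4 / 2 ^ s.length, by positivity, fun t ht => ?_⟩
  have e : place s ⟨-1 / 4, 1⟩ + t = place s ⟨-1 / 4 + t * 2 ^ s.length, 1⟩ := by
    rw [← mul_one (t : ℂ), place_add_smul]
    congr 1
    apply Complex.ext <;> simp only [Complex.add_re, Complex.add_im, Complex.re_ofReal_mul,
      Complex.im_ofReal_mul, Complex.one_re, Complex.one_im] <;> ring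
  have h2 : (0 : ℝ) < 2 ^ s.length := by positivity
  rw [lt_div_iff₀ h2, ← abs_of_pos h2, ← abs_mul, abs_lt] at ht
  clear h2
  generalize t * 2 ^ s.length = u at *
  rw [e]
  refine place_mem_frontier (Or.inr ⟨?_, ?_, le_rfl, ?_⟩) ?_
  · show -1 / 2 ≤ -1 / 4 + u
    linarith
  · show -1 / 4 + u ≤ 3 / 2
    linarith
  · show (1 : ℝ) ≤ 3 / 2
    norm_num
  · rw [Metric.mem_closure_iff]
    intro ε hε
    have h0 : 0 < min (ε / 2) (1 / 2) := lt_min (by linarith) (by norm_num)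
    have h1 := min_le_left (ε / 2) (1 / 2)
    have h2 := min_le_right (ε / 2) (1 / 2)
    generalize min (ε / 2) (1 / 2) = δ at *
    refine ⟨⟨-1 / 4 + u, 1 - δ⟩, ⟨⟨?_, ?_⟩, ⟨?_, ?_⟩, ?_⟩, ?_⟩
    · show -1 < -1 / 4 + u
      linarith
    · show -1 / 4 + u < 2
      linarith
    · show 0 < 1 - δ
      linarith
    · show 1 - δ < 3 / 2
      linarith
    · rintro (⟨h, -⟩ | ⟨-, -, h, -⟩)
      · change 0 ≤ -1 / 4 + u at h
        linarith
      · change 1 ≤ 1 - δ at h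
        linarith
    · refine (dist_le_abs_add_abs _ _).trans_lt ?_
      simp only [sub_self, zero_add, sub_sub_cancel, abs_zero, abs_of_pos h0]
      linarith

/-! ## Curves in the surface -/

theorem continuous_fold : Continuous fold :=
  continuous_quot_lift _ (continuous_subtype_val.comp continuous_snd)

/-- The point of the surface over `p` in the sheet `g`. -/
def pt (g : Sheet) (p : ℂ) (hp : p ∈ table \ corners) : Unfolding := Quot.mk _ (g, ⟨p, hp⟩)

theorem exists_eq_pt (x : Unfolding) : ∃ g hp, x = pt g (fold x) hp := by
  induction x using Quot.ind with
  | mk a => exact ⟨a.1, a.2.2, rfl⟩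

theorem fold_mem_table (x : Unfolding) : fold x ∈ table := by
  obtain ⟨g, hp, -⟩ := exists_eq_pt x
  exact hp.1

theorem edist_fold_le_length {x y : Unfolding} (γ : Path x y) (t : unitInterval) :
    edist (fold x) (fold (γ t)) ≤ length γ := by
  have := eVariationOn.edist_le (fun t => fold (γ t)) (mem_univ 0) (mem_univ t)
  simpa [length] using this

theorem edist_fold_le (x y : Unfolding) : edist (fold x) (fold y) ≤ flatDist x y :=
  le_iInf fun γ => by simpa using edist_fold_le_length γ 1

theorem flatDist_pt_le_edist (g : Sheet) {p q : ℂ}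
    (h : ∀ t ∈ Icc (0 : ℝ) 1, AffineMap.lineMap p q t ∈ table \ corners)
    (hp : p ∈ table \ corners) (hq : q ∈ table \ corners) :
    flatDist (pt g p hp) (pt g q hq) ≤ edist p q := by
  let γ : Path (pt g p hp) (pt g q hq) :=
    { toFun := fun t => pt g (AffineMap.lineMap p q (t : ℝ)) (h t t.2)
      continuous_toFun := by
        refine continuous_quot_mk.comp (continuous_const.prodMk (Continuous.subtype_mk ?_ _))
        exact AffineMap.lineMap_continuous.comp continuous_subtype_val
      source' := by simp
      target' := by simp }
  refine (iInf_le _ γ).trans ?_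
  have h1 : length γ ≤ nndist p q * eVariationOn (Subtype.val : unitInterval → ℝ) univ :=
    (lipschitzWith_lineMap (𝕜 := ℝ) p q).lipschitzOnWith.comp_eVariationOn_le (mapsTo_univ _ _)
  have h2 : eVariationOn (Subtype.val : unitInterval → ℝ) univ = 1 := by
    have := MonotoneOn.eVariationOn_eq (f := (Subtype.val : unitInterval → ℝ)) (s := univ)
      (fun _ _ _ _ h => h) (mem_univ 0) (mem_univ 1)
    rw [univ_inter, show Icc (0 : unitInterval) 1 = univ from Icc_bot_top] at this
    simpa using this
  rwa [h2, mul_one, ← edist_nndist] at h1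

/-! ## Upper bounds for the flat distance -/

/-- Only the starting point of the segment may lie on a side; every later point is interior to the
table, so the segment avoids the corners and stays in one sheet. -/
theorem flatDist_place_le_of_star {s : List Bool} {z c : ℂ} {O : Set ℂ} (hO : IsOpen O)
    (hOt : O ⊆ tPolygon) (h : ∀ t ∈ Ioc (0 : ℝ) 1, AffineMap.lineMap z c t ∈ O) {C : ℝ}
    (hC : dist z c ≤ C) (g : Sheet)
    (hz : place s z ∈ table \ corners) (hc : place s c ∈ table \ corners) :
    flatDist (pt g _ hz) (pt g _ hc) ≤ ENNReal.ofReal (C / 2 ^ s.length) := by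
  refine (flatDist_pt_le_edist g ?_ hz hc).trans ?_
  · intro t ht
    rcases ht.1.eq_or_lt with rfl | h0
    · simpa using hz
    · have e : AffineMap.lineMap (place s z) (place s c) t = place s (AffineMap.lineMap z c t) := by
        rw [place_eq s z, place_eq s c, place_eq s (AffineMap.lineMap z c t)]
        simp only [AffineMap.lineMap_apply_module', Complex.real_smul]
        ring
      have := place_mem_interior (s := s) hO (fun w hw => mem_table.2 ⟨s, w, hOt hw, rfl⟩)
        (h t ⟨h0, ht.2⟩)
      rw [e]
      exact ⟨mem_of_mem_nhds this, notMem_corners_of_mem_nhds this⟩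
  · rw [edist_dist, dist_place]
    gcongr

/-- The open rectangle with the given sides. -/
def openRect (a b c d : ℝ) : Set ℂ := {z | a < z.re ∧ z.re < b ∧ c < z.im ∧ z.im < d}

theorem isOpen_openRect (a b c d : ℝ) : IsOpen (openRect a b c d) :=
  (isOpen_lt continuous_const Complex.continuous_re).inter <|
    (isOpen_lt Complex.continuous_re continuous_const).inter <|
      (isOpen_lt continuous_const Complex.continuous_im).inter
        (isOpen_lt Complex.continuous_im continuous_const)

theorem lineMap_mem_openRect {a b c d : ℝ} {z w : ℂ}
    (hz : a ≤ z.re ∧ z.re ≤ b ∧ c ≤ z.im ∧ z.im ≤ d)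
    (hw : w ∈ openRect a b c d) (t : ℝ) (ht : t ∈ Ioc (0 : ℝ) 1) :
    AffineMap.lineMap z w t ∈ openRect a b c d := by
  obtain ⟨h1, h2, h3, h4⟩ := hz
  obtain ⟨k1, k2, k3, k4⟩ := hw
  obtain ⟨t0, t1⟩ := ht
  simp only [openRect, mem_ofPred_eq, AffineMap.lineMap_apply_module', Complex.add_re,
    Complex.add_im, Complex.smul_re, Complex.smul_im, Complex.sub_re, Complex.sub_im, smul_eq_mul]
  refine ⟨?_, ?_, ?_, ?_⟩ <;> nlinarith

/-- The centre of the square of the T-shaped polygon. -/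
def centre : ℂ := ⟨1 / 2, 1 / 2⟩

/-- The centre of the bar of the T-shaped polygon. -/
def barCentre : ℂ := ⟨1 / 2, 5 / 4⟩

theorem square_subset : openRect 0 1 0 1 ⊆ tPolygon :=
  fun _ h => Or.inl ⟨h.1.le, h.2.1.le, h.2.2.1.le, h.2.2.2.le⟩

theorem bar_subset : openRect (-1 / 2) (3 / 2) 1 (3 / 2) ⊆ tPolygon :=
  fun _ h => Or.inr ⟨h.1.le, h.2.1.le, h.2.2.1.le, h.2.2.2.le⟩

theorem column_subset : openRect 0 1 0 (3 / 2) ⊆ tPolygon := fun z h => by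
  obtain ⟨h1, h2, h3, h4⟩ := h
  rcases le_total z.im 1 with h5 | h5
  · exact Or.inl ⟨h1.le, h2.le, h3.le, h5⟩
  · exact Or.inr ⟨by linarith, by linarith, h5, h4.le⟩

theorem place_mem_nhds (s : List Bool) {z : ℂ} (hz : z ∈ openRect 0 1 0 (3 / 2)) :
    table ∈ 𝓝 (place s z) :=
  place_mem_interior (isOpen_openRect _ _ _ _)
    (fun w hw => mem_table.2 ⟨s, w, column_subset hw, rfl⟩) hz

theorem place_column_mem (s : List Bool) {z : ℂ} (hz : z ∈ openRect 0 1 0 (3 / 2)) :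
    place s z ∈ table \ corners :=
  ⟨mem_of_mem_nhds (place_mem_nhds s hz), notMem_corners_of_mem_nhds (place_mem_nhds s hz)⟩

theorem centre_mem_column : centre ∈ openRect 0 1 0 (3 / 2) := by
  norm_num [centre, openRect]

theorem place_centre_mem (s : List Bool) : place s centre ∈ table \ corners :=
  place_column_mem s centre_mem_column

/-- The polygon is not star-shaped about `centre`, so points of the bar first go to `barCentre`. -/
theorem flatDist_centre_le (g : Sheet) {s : List Bool} {z : ℂ} (hz : z ∈ tPolygon)
    (hp : place s z ∈ table \ corners) :
    flatDist (pt g _ hp) (pt g _ (place_centre_mem s)) ≤ ENNReal.ofReal (4 / 2 ^ s.length) := by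
  rcases hz with hz | hz
  · refine flatDist_place_le_of_star (isOpen_openRect 0 1 0 1) square_subset
      (lineMap_mem_openRect hz (by norm_num [centre, openRect])) ?_ g hp _
    obtain ⟨h1, h2, h3, h4⟩ := hz
    have h5 : |z.re - centre.re| ≤ 2 := by
      rw [abs_le]; constructor <;> simp only [centre] <;> linarith
    have h6 : |z.im - centre.im| ≤ 2 := by
      rw [abs_le]; constructor <;> simp only [centre] <;> linarith
    linarith [dist_le_abs_add_abs z centre]
  · have hb : place s barCentre ∈ table \ corners :=
      place_column_mem s (by norm_num [barCentre, openRect])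
    refine (flatDist_triangle _ (pt g _ hb) _).trans ?_
    rw [show (4 : ℝ) / 2 ^ s.length = 2 / 2 ^ s.length + 2 / 2 ^ s.length by ring,
      ENNReal.ofReal_add (by positivity) (by positivity)]
    refine add_le_add ?_ ?_
    · refine flatDist_place_le_of_star (isOpen_openRect (-1 / 2) (3 / 2) 1 (3 / 2)) bar_subset
        (lineMap_mem_openRect hz (by norm_num [barCentre, openRect])) ?_ g hp _
      obtain ⟨h1, h2, h3, h4⟩ := hz
      have h5 : |z.re - barCentre.re| ≤ 1 := by
        rw [abs_le]; constructor <;> simp only [barCentre] <;> linarith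
      have h6 : |z.im - barCentre.im| ≤ 1 := by
        rw [abs_le]; constructor <;> simp only [barCentre] <;> linarith
      linarith [dist_le_abs_add_abs z barCentre]
    · refine flatDist_place_le_of_star (isOpen_openRect 0 1 0 (3 / 2)) column_subset
        (lineMap_mem_openRect (by norm_num [barCentre]) centre_mem_column) ?_ g hb _
      refine (dist_le_abs_add_abs barCentre centre).trans ?_
      norm_num [barCentre, centre]

theorem flatDist_sheets_le {g g' : Sheet} {s : List Bool} {z : ℂ} (hz : z ∈ tPolygon)
    (hp : place s z ∈ table \ corners) (h : pt g _ hp = pt g' _ hp) :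
    flatDist (pt g _ (place_centre_mem s)) (pt g' _ (place_centre_mem s)) ≤
      ENNReal.ofReal (8 / 2 ^ s.length) := by
  refine (flatDist_triangle _ (pt g _ hp) _).trans ?_
  rw [show (8 : ℝ) / 2 ^ s.length = 4 / 2 ^ s.length + 4 / 2 ^ s.length by ring,
    ENNReal.ofReal_add (by positivity) (by positivity)]
  refine add_le_add ?_ ?_
  · rw [flatDist_comm]
    exact flatDist_centre_le g hz hp
  · rw [h]
    exact flatDist_centre_le g' hz hp

theorem flatDist_vertical_le (a b : Bool) (s : List Bool) :
    flatDist (pt (a, b) _ (place_centre_mem s)) (pt (!a, b) _ (place_centre_mem s)) ≤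
      ENNReal.ofReal (8 / 2 ^ s.length) := by
  have hz : (⟨0, 1 / 2⟩ : ℂ) ∈ tPolygon := Or.inl (by norm_num)
  have hv := onVerticalSide_place s
  exact flatDist_sheets_le hz ⟨mem_table.2 ⟨s, _, hz, rfl⟩, fun hc => hc.2.1 hv⟩
    (Quot.sound (Glue.vertical a b _ hv))

theorem flatDist_horizontal_le (a b : Bool) (s : List Bool) :
    flatDist (pt (a, b) _ (place_centre_mem s)) (pt (a, !b) _ (place_centre_mem s)) ≤
      ENNReal.ofReal (8 / 2 ^ s.length) := by
  have hz : (⟨-1 / 4, 1⟩ : ℂ) ∈ tPolygon := Or.inr (by norm_num)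
  have hv := onHorizontalSide_place s
  exact flatDist_sheets_le hz ⟨mem_table.2 ⟨s, _, hz, rfl⟩, fun hc => hc.2.2 hv⟩
    (Quot.sound (Glue.horizontal a b _ hv))

/-- The two reflections generate all sheets: change each coordinate of the sheet separately, at cost
`8` each. -/
theorem flatDist_centres_le (g g' : Sheet) (s : List Bool) :
    flatDist (pt g _ (place_centre_mem s)) (pt g' _ (place_centre_mem s)) ≤
      ENNReal.ofReal (16 / 2 ^ s.length) := by
  obtain ⟨a, b⟩ := g
  obtain ⟨a', b'⟩ := g'
  refine (flatDist_triangle _ (pt (a', b) _ (place_centre_mem s)) _).trans ?_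
  rw [show (16 : ℝ) / 2 ^ s.length = 8 / 2 ^ s.length + 8 / 2 ^ s.length by ring,
    ENNReal.ofReal_add (by positivity) (by positivity)]
  refine add_le_add ?_ ?_
  · obtain rfl | rfl : a' = a ∨ a' = !a := by cases a <;> cases a' <;> simp
    · rw [flatDist_self]; exact bot_le
    · exact flatDist_vertical_le a b s
  · obtain rfl | rfl : b' = b ∨ b' = !b := by cases b <;> cases b' <;> simp
    · rw [flatDist_self]; exact bot_le
    · exact flatDist_horizontal_le a' b s

theorem flatDist_le_of_mem_cell {s : List Bool} {x y : Unfolding} (hx : fold x ∈ cell s)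
    (hy : fold y ∈ cell s) : flatDist x y ≤ ENNReal.ofReal (24 / 2 ^ s.length) := by
  have key : ∀ x : Unfolding, fold x ∈ cell s → ∃ g, flatDist x (pt g _ (place_centre_mem s)) ≤
      ENNReal.ofReal (4 / 2 ^ s.length) := by
    intro x hx
    obtain ⟨g, hp, e⟩ := exists_eq_pt x
    obtain ⟨z, hz, e'⟩ := hx
    generalize fold x = p at *
    subst e' e
    exact ⟨g, flatDist_centre_le g hz hp⟩
  obtain ⟨g, hg⟩ := key x hx
  obtain ⟨g', hg'⟩ := key y hy
  rw [flatDist_comm] at hg'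
  refine ((flatDist_triangle _ _ _).trans (add_le_add ((flatDist_triangle _ _ _).trans
    (add_le_add hg (flatDist_centres_le g g' s))) hg')).trans (le_of_eq ?_)
  rw [← ENNReal.ofReal_add (by positivity) (by positivity),
    ← ENNReal.ofReal_add (by positivity) (by positivity)]
  congr 1
  ring

/-- The midpoint of the seam between the two copies. It is not a corner, because an open rectangle
straddling the seam lies in the table. -/
theorem exists_fold_mem_cell_inter (s : List Bool) (b : Bool) :
    ∃ x : Unfolding, fold x ∈ cell s ∧ fold x ∈ cell (s ++ [b]) := by
  -- The left end of the seam, in the coordinates of the copy `s`; the seam has length `1 / 2`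
  -- there.
  set l : ℝ := if b then 1 else -1 / 2 with hl
  have hl' : -1 / 2 ≤ l ∧ l ≤ 1 := by rw [hl]; split_ifs <;> norm_num
  have hO : ∀ z ∈ openRect l (l + 1 / 2) 1 2, place s z ∈ table := by
    rintro z ⟨h1, h2, h3, h4⟩
    rw [mem_table]
    rcases le_total z.im (3 / 2) with h5 | h5
    · exact ⟨s, z, Or.inr ⟨by linarith, by linarith, h3.le, h5⟩, rfl⟩
    · refine ⟨s ++ [b], ⟨2 * (z.re - l), 2 * (z.im - 3 / 2)⟩, Or.inl ⟨?_, ?_, ?_, ?_⟩, ?_⟩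
      · show 0 ≤ 2 * (z.re - l)
        linarith
      · show 2 * (z.re - l) ≤ 1
        linarith
      · show 0 ≤ 2 * (z.im - 3 / 2)
        linarith
      · show 2 * (z.im - 3 / 2) ≤ 1
        linarith
      · rw [place_append]
        congr 1
        apply Complex.ext
        · rw [place, attach_re]
          simp only [place, ← hl]
          ring
        · rw [place, attach_im]
          simp only [place]
          ring
  have hm : (⟨l + 1 / 4, 3 / 2⟩ : ℂ) ∈ openRect l (l + 1 / 2) 1 2 := by
    norm_num [openRect]
  have hn := place_mem_interior (isOpen_openRect _ _ _ _) hO hm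
  refine ⟨pt (false, false) _ ⟨mem_of_mem_nhds hn, notMem_corners_of_mem_nhds hn⟩,
    ⟨_, Or.inr ⟨?_, ?_, ?_, le_rfl⟩, rfl⟩, ⟨⟨1 / 2, 0⟩, Or.inl (by norm_num), ?_⟩⟩
  · show -1 / 2 ≤ l + 1 / 4
    linarith
  · show l + 1 / 4 ≤ 3 / 2
    linarith
  · show (1 : ℝ) ≤ 3 / 2
    norm_num
  · rw [place_append]
    refine congrArg (place s) (Complex.ext ?_ ?_)
    · rw [place, attach_re]
      simp only [place, ← hl]
      ring
    · rw [place, attach_im]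
      simp only [place]
      ring

/-- Descending one copy at a time costs a geometric series; `48` solves `C = C / 2 + 24`. -/
theorem flatDist_le_of_mem_cell_append {s t : List Bool} {x y : Unfolding}
    (hx : fold x ∈ cell (s ++ t)) (hy : fold y ∈ cell s) :
    flatDist x y ≤ ENNReal.ofReal (48 / 2 ^ s.length) := by
  induction t generalizing s y with
  | nil =>
    rw [List.append_nil] at hx
    refine (flatDist_le_of_mem_cell hx hy).trans (ENNReal.ofReal_le_ofReal ?_)
    gcongr
    norm_num
  | cons b t ih =>
    obtain ⟨q, hq, hq'⟩ := exists_fold_mem_cell_inter s b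
    have h1 := ih (s := s ++ [b]) (y := q) (by simpa using hx) hq'
    refine ((flatDist_triangle _ q _).trans
      (add_le_add h1 (flatDist_le_of_mem_cell hq hy))).trans (le_of_eq ?_)
    rw [← ENNReal.ofReal_add (by positivity) (by positivity)]
    congr 1
    simp only [List.length_append, List.length_singleton, pow_succ]
    ring

theorem flatDist_le_of_mem_subtree {s t t' : List Bool} {x y : Unfolding}
    (hx : fold x ∈ cell (s ++ t)) (hy : fold y ∈ cell (s ++ t')) :
    flatDist x y ≤ ENNReal.ofReal (96 / 2 ^ s.length) := by
  obtain ⟨q, hq, -⟩ := exists_fold_mem_cell_inter s true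
  refine ((flatDist_triangle _ q _).trans (add_le_add (flatDist_le_of_mem_cell_append hx hq)
    ((flatDist_comm q y).trans_le (flatDist_le_of_mem_cell_append hy hq)))).trans (le_of_eq ?_)
  rw [← ENNReal.ofReal_add (by positivity) (by positivity)]
  congr 1
  ring

/-! ## A lower bound for the flat distance -/

/-- Above height `n` every point of the curve lies over a copy of length at least `n`, hence in the
strip of a prefix of length `n`. These strips are open and disjoint, so connectedness of the
interval forbids passing from one to another. -/
theorem exists_im_le_height {n : ℕ} {s s' t t' : List Bool} (hs : s.length = n)
    (hs' : s'.length = n) (hne : s ≠ s') {x y : Unfolding} (hx : fold x ∈ cell (s ++ t))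
    (hy : fold y ∈ cell (s' ++ t')) (γ : Path x y) : ∃ u, (fold (γ u)).im ≤ height n := by
  by_contra! hγ
  -- Whole vertical strips replace the closed cells, so that the preimages are open.
  let A : List Bool → Set unitInterval :=
    fun r => (fun u => fold (γ u)) ⁻¹' (place r '' {z | z.re ∈ Ioo (-1 : ℝ) 2})
  have hA : ∀ r, IsOpen (A r) := fun r =>
    (isOpenMap_place r _ (isOpen_Ioo.preimage Complex.continuous_re)).preimage
      (continuous_fold.comp γ.continuous)
  have hcell : ∀ r r' u, fold (γ u) ∈ cell (r ++ r') → u ∈ A r := by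
    rintro r r' u ⟨z, hz, e⟩
    exact ⟨place r' z, place_re_mem _ (tPolygon_re hz), by rw [← place_append, e]⟩
  have hdisj : ∀ r r' u, r.length = r'.length → u ∈ A r → u ∈ A r' → r = r' := by
    rintro r r' u h ⟨z, hz, e⟩ ⟨w, hw, e'⟩
    exact (place_inj h hz hw (e.trans e'.symm)).1
  have hcov : (univ : Set unitInterval) ⊆ A s ∪ ⋃ r ∈ {r | r.length = n ∧ r ≠ s}, A r := by
    intro u _
    obtain ⟨r, hr⟩ := mem_table.1 (fold_mem_table (γ u))
    have hlen : n < r.length + 1 := height_strictMono.lt_iff_lt.1 ((hγ u).trans_le (cell_im hr).2)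
    rw [← List.take_append_drop n r] at hr
    by_cases h : r.take n = s
    · exact Or.inl (h ▸ hcell _ _ u hr)
    · exact Or.inr (mem_biUnion ⟨by rw [List.length_take]; omega, h⟩ (hcell _ _ u hr))
  have h0 : (0 : unitInterval) ∈ A s := hcell s t 0 (by simpa using hx)
  have h1 : (1 : unitInterval) ∈ A s' := hcell s' t' 1 (by simpa using hy)
  rcases isPreconnected_iff_subset_of_disjoint.1 isPreconnected_univ _ _ (hA s)
    (isOpen_biUnion fun r _ => hA r) hcov (by
      rw [univ_inter, ← disjoint_iff_inter_eq_empty, disjoint_left]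
      intro u hu hu'
      obtain ⟨r, ⟨hr, hne'⟩, hur⟩ := mem_iUnion₂.1 hu'
      exact hne' (hdisj r s u (hr.trans hs.symm) hur hu)) with h | h
  · exact hne (hdisj s s' 1 (hs.trans hs'.symm) (h (mem_univ _)) h1)
  · obtain ⟨r, ⟨hr, hne'⟩, hur⟩ := mem_iUnion₂.1 (h (mem_univ 0))
    exact hne' (hdisj r s 0 (hr.trans hs.symm) hur h0)

theorem ofReal_im_sub_le_edist (p q : ℂ) : ENNReal.ofReal (p.im - q.im) ≤ edist p q := by
  rw [edist_dist, Complex.dist_eq]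
  exact ENNReal.ofReal_le_ofReal ((le_abs_self _).trans (Complex.abs_im_le_norm (p - q)))

theorem le_flatDist_of_ne {n : ℕ} {s s' t t' : List Bool} (hs : s.length = n)
    (hs' : s'.length = n) (hne : s ≠ s') {x y : Unfolding} (hx : fold x ∈ cell (s ++ t))
    (hy : fold y ∈ cell (s' ++ t')) :
    ENNReal.ofReal ((fold x).im - height n) ≤ flatDist x y := by
  refine le_iInf fun γ => ?_
  obtain ⟨u, hu⟩ := exists_im_le_height hs hs' hne hx hy γ
  exact (ENNReal.ofReal_le_ofReal (by linarith)).trans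
    ((ofReal_im_sub_le_edist _ _).trans (edist_fold_le_length γ u))

/-! ## Subtrees and branches -/

/-- The part of the surface lying over the copies whose index extends `s`. -/
def subtree (s : List Bool) : Set Surface := {x | ∃ t, fold x ∈ cell (s ++ t)}

theorem edist_le_of_mem_subtree {s : List Bool} {x y : Surface} (hx : x ∈ subtree s)
    (hy : y ∈ subtree s) : edist x y ≤ ENNReal.ofReal (96 / 2 ^ s.length) := by
  obtain ⟨t, ht⟩ := hx
  obtain ⟨t', ht'⟩ := hy
  exact flatDist_le_of_mem_subtree ht ht'

theorem eq_of_mem_subtree {s s' : List Bool} (h : s.length = s'.length) {x : Surface}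
    (hx : x ∈ subtree s) (hx' : x ∈ subtree s') : s = s' := by
  obtain ⟨t, ht⟩ := hx
  obtain ⟨t', ht'⟩ := hx'
  exact eq_of_mem_cell_append h ht ht'

theorem subtree_anti {s s' : List Bool} (h : s <+: s') : subtree s' ⊆ subtree s := by
  rintro x ⟨t, ht⟩
  obtain ⟨u, rfl⟩ := h
  exact ⟨u ++ t, by rwa [← List.append_assoc]⟩

theorem mem_subtree_of_mem_cell {s : List Bool} {x : Surface} (h : fold x ∈ cell s) :
    x ∈ subtree s := ⟨[], by rwa [List.append_nil]⟩

/-! ### Labels, climbing sequences and branches -/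

theorem fold_mem_cell_label (x : Surface) : fold x ∈ cell (label x) :=
  Function.argminOn_mem List.length _ (exists_mem_puncturedQuadT x)

theorem mem_subtree_label (x : Surface) : x ∈ subtree (label x) :=
  mem_subtree_of_mem_cell (fold_mem_cell_label x)

/-- The centre of a square lies in no other copy, so its label is forced. -/
theorem exists_label_eq (s : List Bool) : ∃ x : Surface, label x = s :=
  ⟨pt (false, false) _ (place_centre_mem s),
    (eq_of_place_mem_cell (by norm_num [centre]) (by norm_num [centre])
      (fold_mem_cell_label (pt (false, false) _ (place_centre_mem s)))).1⟩

theorem length_prefixOf (w : ℕ → Bool) (n : ℕ) : (prefixOf w n).length = n := by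
  simp [prefixOf]

theorem prefixOf_prefix (w : ℕ → Bool) {n m : ℕ} (h : n ≤ m) : prefixOf w n <+: prefixOf w m := by
  rw [List.prefix_iff_eq_take]
  apply List.ext_getElem <;> simp [prefixOf, h]

theorem prefixOf_injective : Function.Injective prefixOf := by
  intro w w' h
  funext k
  exact congrFun (List.ofFn_injective (congrFun h (k + 1))) (Fin.last k)

theorem Climbs.prefix {y : ℕ → Surface} (hy : Climbs y) {n m : ℕ} (h : n ≤ m) :
    label (y n) <+: label (y m) := by
  induction m, h using Nat.le_induction with
  | base => exact List.prefix_rfl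
  | succ m _ ih => exact ih.trans (hy m).2

theorem Climbs.eventually_mem_subtree {y : ℕ → Surface} (hy : Climbs y) (n : ℕ) :
    ∀ᶠ m in atTop, y m ∈ subtree (label (y n)) :=
  eventually_atTop.2 ⟨n, fun m h => subtree_anti (hy.prefix h) (mem_subtree_label (y m))⟩

theorem climbs_of_label_eq {w : ℕ → Bool} {y : ℕ → Surface}
    (hy : ∀ n, label (y n) = prefixOf w n) : Climbs y := fun n => by
  rw [hy, hy]
  exact ⟨length_prefixOf w n, prefixOf_prefix w n.le_succ⟩

theorem exists_label_eq_prefixOf (w : ℕ → Bool) :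
    ∃ y : ℕ → Surface, ∀ n, label (y n) = prefixOf w n := by
  choose y hy using exists_label_eq
  exact ⟨fun n => y (prefixOf w n), fun n => hy _⟩

/-- The filter of the neighbourhoods of the end of the branch `w`. -/
def branch (w : ℕ → Bool) : Filter Surface := ⨅ n, 𝓟 (subtree (prefixOf w n))

theorem subtree_mem_branch (w : ℕ → Bool) (n : ℕ) : subtree (prefixOf w n) ∈ branch w :=
  mem_iInf_of_mem n (mem_principal_self _)

theorem tendsto_branch {w : ℕ → Bool} {y : ℕ → Surface} (hy : ∀ n, label (y n) = prefixOf w n) :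
    Tendsto y atTop (branch w) :=
  tendsto_iInf.2 fun n => tendsto_principal.2 <|
    hy n ▸ (climbs_of_label_eq hy).eventually_mem_subtree n

theorem cauchy_branch (w : ℕ → Bool) : Cauchy (branch w) := by
  obtain ⟨y, hy⟩ := exists_label_eq_prefixOf w
  rw [EMetric.cauchy_iff]
  refine ⟨((tendsto_branch hy).neBot).ne, fun ε hε => ?_⟩
  have h : Tendsto (fun n : ℕ => ENNReal.ofReal (96 / 2 ^ n)) atTop (𝓝 0) := by
    rw [← ENNReal.ofReal_zero]
    exact (ENNReal.continuous_ofReal.tendsto 0).comp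
      (tendsto_const_nhds.div_atTop (tendsto_pow_atTop_atTop_of_one_lt one_lt_two))
  obtain ⟨n, hn⟩ := (h.eventually (gt_mem_nhds hε)).exists
  refine ⟨_, subtree_mem_branch w n, fun a ha b hb => (edist_le_of_mem_subtree ha hb).trans_lt ?_⟩
  rwa [length_prefixOf]

/-! ### Points of the completion and ends of branches -/

/-- The trace on the surface of the neighbourhoods of a point of the completion. -/
def trace (x : SurfaceCompletion) : Filter Surface :=
  comap (fun z : Surface => (z : SurfaceCompletion)) (𝓝 x)

instance (x : SurfaceCompletion) : (trace x).NeBot :=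
  UniformSpace.Completion.isDenseInducing_coe.comap_nhds_neBot x

theorem exists_mem_trace_edist_lt (x : SurfaceCompletion) {ε : ENNReal} (hε : 0 < ε) :
    ∃ A ∈ trace x, ∀ a ∈ A, ∀ b ∈ A, edist a b < ε := by
  have : (comap (fun z : Surface => (z : SurfaceCompletion)) (𝓝 x)).NeBot :=
    inferInstanceAs (trace x).NeBot
  have h : Cauchy (trace x) := cauchy_nhds.comap
    (UniformSpace.Completion.isUniformInducing_coe Surface).comap_uniformity.le
  exact (EMetric.cauchy_iff.1 h).2 ε hε

theorem eq_of_trace_le {x x' : SurfaceCompletion} {F : Filter Surface}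
    (hF : Tendsto (fun z : Surface => (z : SurfaceCompletion)) F (𝓝 x')) (h : trace x ≤ F) :
    x = x' :=
  tendsto_nhds_unique (f := fun z : Surface => (z : SurfaceCompletion)) (l := trace x)
    tendsto_comap (hF.mono_left h)

theorem height_lt_of_edist_lt {a b : Surface} {n : ℕ}
    (h : edist a b < ENNReal.ofReal (height (n + 1) - height n))
    (hb : height (n + 1) ≤ (fold b).im) : height n < (fold a).im := by
  have h1 := ((ofReal_im_sub_le_edist (fold b) (fold a)).trans
    ((edist_comm _ _).trans_le (edist_fold_le a b))).trans_lt h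
  linarith [(ENNReal.ofReal_lt_ofReal_iff'.1 h1).1]

theorem ofReal_height_pos (n : ℕ) : 0 < ENNReal.ofReal (height (n + 1) - height n) :=
  ENNReal.ofReal_pos.2 (sub_pos.2 (height_strictMono n.lt_succ_self))

theorem mem_elusive_of_tendsto_branch {w : ℕ → Bool} {x : SurfaceCompletion}
    (h : Tendsto (fun z : Surface => (z : SurfaceCompletion)) (branch w) (𝓝 x)) :
    x ∈ elusive := by
  intro hx
  obtain ⟨s, hs⟩ := mem_iUnion.1 hx
  -- With this `n`, `height n` is the top of the copy `s`, while the branch has points above `height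
  -- (n + 1)` arbitrarily near its limit.
  set n := s.length + 1
  obtain ⟨A, hA, hAε⟩ := exists_mem_trace_edist_lt x (ofReal_height_pos n)
  obtain ⟨N, hN, hNA⟩ := mem_comap.1 hA
  obtain ⟨_, haN, a, ha, rfl⟩ := mem_closure_iff_nhds.1 hs N hN
  have := (cauchy_branch w).1
  obtain ⟨b, hbA, t, hb⟩ := (branch w).nonempty_of_mem
    (inter_mem (map_le_iff_le_comap.1 h hA) (subtree_mem_branch w (n + 1)))
  refine (height_lt_of_edist_lt (hAε a (hNA haN) b hbA) (le_trans ?_ (cell_im hb).1)).not_ge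
    (cell_im ha).2
  exact height_strictMono.monotone (by rw [List.length_append, length_prefixOf]; omega)

/-- Close to `x` all points have height at least `height (n + 1)` and mutual distance below `height
(n + 1) - height n`, too little to come down to `height n` and change subtree. -/
theorem exists_subtree_mem_trace {x : SurfaceCompletion} (hx : x ∈ elusive) (n : ℕ) :
    ∃ s : List Bool, s.length = n ∧ subtree s ∈ trace x := by
  obtain ⟨A, hA, hAε⟩ := exists_mem_trace_edist_lt x (ofReal_height_pos n)
  have hB : {z : Surface | ∀ s : List Bool, s.length < n + 1 → z ∉ puncturedQuadT s} ∈ trace x := by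
    have h : x ∉ closure (⋃ s ∈ {s : List Bool | s.length < n + 1},
        (fun z : Surface => (z : SurfaceCompletion)) '' puncturedQuadT s) := by
      -- Finiteness is essential: it makes the closure of the union the union of the quad-T
      -- subsurfaces.
      rw [(List.finite_length_lt Bool (n + 1)).closure_biUnion]
      intro h
      obtain ⟨s, -, hs⟩ := mem_iUnion₂.1 h
      exact hx (mem_iUnion.2 ⟨s, hs⟩)
    refine mem_of_superset (preimage_mem_comap (isClosed_closure.isOpen_compl.mem_nhds h)) ?_
    exact fun z hz s hs hzs => hz (subset_closure (mem_biUnion hs (mem_image_of_mem _ hzs)))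
  have key : ∀ z : Surface, (∀ s : List Bool, s.length < n + 1 → z ∉ puncturedQuadT s) →
      ∃ s t : List Bool, s.length = n ∧ fold z ∈ cell (s ++ t) ∧ height (n + 1) ≤ (fold z).im := by
    intro z hz
    obtain ⟨r, hr⟩ := mem_table.1 (fold_mem_table z)
    have hlen : n + 1 ≤ r.length := not_lt.1 fun h => hz r h hr
    refine ⟨r.take n, r.drop n, by rw [List.length_take]; omega, ?_,
      (height_strictMono.monotone hlen).trans (cell_im hr).1⟩
    rwa [List.take_append_drop]
  obtain ⟨z, hzA, hzB⟩ := (trace x).nonempty_of_mem (inter_mem hA hB)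
  obtain ⟨s, t, hs, hz, him⟩ := key z hzB
  refine ⟨s, hs, mem_of_superset (inter_mem hA hB) ?_⟩
  rintro z' ⟨hzA', hzB'⟩
  obtain ⟨s', t', hs', hz', -⟩ := key z' hzB'
  by_contra hne
  have hss : s ≠ s' := by
    rintro rfl
    exact hne ⟨t', hz'⟩
  have h1 := (le_flatDist_of_ne hs hs' hss hz hz').trans_lt (hAε z hzA z' hzA')
  linarith [(ENNReal.ofReal_lt_ofReal_iff'.1 h1).1]

/-- The end of the branch `w`, a point of the completion of the surface. -/
def branchEnd (w : ℕ → Bool) : SurfaceCompletion :=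
  (CompleteSpace.complete
    ((cauchy_branch w).map (UniformSpace.Completion.uniformContinuous_coe Surface))).choose

theorem tendsto_branchEnd (w : ℕ → Bool) :
    Tendsto (fun z : Surface => (z : SurfaceCompletion)) (branch w) (𝓝 (branchEnd w)) :=
  (CompleteSpace.complete
    ((cauchy_branch w).map (UniformSpace.Completion.uniformContinuous_coe Surface))).choose_spec

theorem branchEnd_mem_elusive (w : ℕ → Bool) : branchEnd w ∈ elusive :=
  mem_elusive_of_tendsto_branch (tendsto_branchEnd w)

/-- The level `n` subtree near the limit meets both the tail of `y` and the branch `w`; disjointness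
identifies its index with the label and with the prefix. -/
theorem label_eq_prefixOf_of_tendsto {w : ℕ → Bool} {y : ℕ → Surface} (hy : Climbs y)
    (h : Tendsto (fun n => (y n : SurfaceCompletion)) atTop (𝓝 (branchEnd w))) (n : ℕ) :
    label (y n) = prefixOf w n := by
  obtain ⟨s, hs, hsx⟩ := exists_subtree_mem_trace (branchEnd_mem_elusive w) n
  have h1 : Tendsto y atTop (trace (branchEnd w)) := tendsto_comap_iff.2 h
  obtain ⟨m, hm, hm'⟩ := ((h1.eventually hsx).and (hy.eventually_mem_subtree n)).exists
  have := (cauchy_branch w).1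
  obtain ⟨b, hb, hb'⟩ := (branch w).nonempty_of_mem
    (inter_mem (map_le_iff_le_comap.1 (tendsto_branchEnd w) hsx) (subtree_mem_branch w n))
  rw [eq_of_mem_subtree ((hy n).1.trans hs.symm) hm' hm,
    eq_of_mem_subtree (hs.trans (length_prefixOf w n).symm) hb hb']

theorem branchEnd_injective : Function.Injective branchEnd := by
  intro w w' h
  obtain ⟨y, hy⟩ := exists_label_eq_prefixOf w
  have h1 := (tendsto_branchEnd w).comp (tendsto_branch hy)
  rw [h] at h1
  exact prefixOf_injective (funext fun n =>
    (hy n).symm.trans (label_eq_prefixOf_of_tendsto (climbs_of_label_eq hy) h1 n))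

theorem exists_branchEnd_eq {x : SurfaceCompletion} (hx : x ∈ elusive) :
    ∃ w, branchEnd w = x := by
  choose s hs hsx using exists_subtree_mem_trace hx
  have hpre : ∀ {n m : ℕ}, n ≤ m → s n = (s m).take n := by
    intro n m h
    obtain ⟨z, hz, hz'⟩ := (trace x).nonempty_of_mem (inter_mem (hsx n) (hsx m))
    refine eq_of_mem_subtree ?_ hz (subtree_anti (List.take_prefix n (s m)) hz')
    rw [List.length_take, hs, hs, min_eq_left h]
  -- Bit `k` is read from `s (k + 1)`, the shortest index that contains it; `hpre` makes longer ones
  -- agree.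
  refine ⟨fun k => (s (k + 1))[k]'(by rw [hs]; omega),
    (eq_of_trace_le (tendsto_branchEnd _) ?_).symm⟩
  refine le_iInf fun n => le_principal_iff.2 ?_
  convert hsx n using 2
  refine List.ext_getElem (by rw [length_prefixOf, hs]) fun k h1 h2 => ?_
  rw [hs] at h2
  simp only [prefixOf, List.getElem_ofFn]
  rw [List.getElem_of_eq (hpre (show k + 1 ≤ n by omega)), List.getElem_take]

/-- The elusive singularities are the ends of the branches. -/
def branchEndEquiv : (ℕ → Bool) ≃ elusive :=
  Equiv.ofBijective (fun w => ⟨branchEnd w, branchEnd_mem_elusive w⟩)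
    ⟨fun _ _ h => branchEnd_injective (congrArg Subtype.val h), fun x =>
      (exists_branchEnd_eq x.2).imp fun _ h => Subtype.ext h⟩

end TFractal

end

theorem mainTheorem2 :
    ∃ α : TFractal.elusive ≃ (ℕ → Bool),
      (∀ x : TFractal.elusive, ∃ y : ℕ → TFractal.Surface, CauchySeq y ∧ TFractal.Climbs y ∧
        Tendsto (fun n => (y n : TFractal.SurfaceCompletion)) atTop (𝓝 x)) ∧
      (∀ (x : TFractal.elusive) (y : ℕ → TFractal.Surface), TFractal.Climbs y →
        (Tendsto (fun n => (y n : TFractal.SurfaceCompletion)) atTop (𝓝 x) ↔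
          ∀ n, TFractal.label (y n) = TFractal.prefixOf (α x) n)) := by
  refine ⟨TFractal.branchEndEquiv.symm, fun x => ?_, fun x y hy => ?_⟩
  · obtain ⟨w, rfl⟩ := TFractal.branchEndEquiv.surjective x
    obtain ⟨y, hy⟩ := TFractal.exists_label_eq_prefixOf w
    exact ⟨y, (TFractal.cauchy_branch w).mono (TFractal.tendsto_branch hy),
      TFractal.climbs_of_label_eq hy,
      (TFractal.tendsto_branchEnd w).comp (TFractal.tendsto_branch hy)⟩
  · obtain ⟨w, rfl⟩ := TFractal.branchEndEquiv.surjective x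
    rw [Equiv.symm_apply_apply]
    exact ⟨TFractal.label_eq_prefixOf_of_tendsto hy, fun h =>
      (TFractal.tendsto_branchEnd w).comp (TFractal.tendsto_branch h)⟩
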